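/- A loop is a set $Q$ with a product having a two-sided identity $1$ and such that, for all $a,b\in Q$, the equations $ax=b$ and $ya=b$ have unique solutions $x$ and $y$. An \emph{extra loop} is a loop that is both conjugacy closed (the set of left translations and the set of right translations are each closed under conjugation) and a Moufang loop ($xy\cdot zx = x\cdot(yz\cdot x)$ for all $x,y,z$). The associator $(x,y,z)$ is defined by $(x\cdot yz)\,(x,y,z)=xy\cdot z$, and $A(Q)$ is the subloop of $Q$ generated by all associators. The nucleus $N(Q)$ consists of all $a\in Q$ with $ax\cdot y=a\cdot xy$, $xa\cdot y=x\cdot ay$ and $xy\cdot a=x\cdot ya$ for all $x,y\in Q$; the center $Z(Q)$ consists of the elements of $N(Q)$ that commute with every element of $Q$; $|Q:N(Q)|$ is the number of left cosets of $N(Q)$ in $Q$. \textbf{Theorem.} Let $Q$ be a finite extra loop. If some associator $(x,y,z)$ with $x,y,z\in Q$ is not contained in $Z(Q)$, then $|A(Q)|\ge 32$ and $|Q:N(Q)|\ge 16$, and $512$ divides $|Q|$. Consequently, if $|Q|<512$, then the quotient loop $Q/Z(Q)$ is a group. -/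

import Mathlib

namespace LoopTheory

universe u

/-- A loop: a set with a two-sided identity in which, for all `a` and `b`, the equations
`a * x = b` and `y * a = b` have the unique solutions `x = a \ b = ldiv a b` and
`y = b / a = rdiv b a`. (The divisions are determined by the product.) -/
class Loop (Q : Type u) extends MulOneClass Q where
  ldiv : Q → Q → Q
  rdiv : Q → Q → Q
  mul_ldiv : ∀ a b : Q, a * ldiv a b = b
  ldiv_mul : ∀ a b : Q, ldiv a (a * b) = b
  rdiv_mul : ∀ b a : Q, rdiv b a * a = b
  mul_rdiv : ∀ b a : Q, rdiv (b * a) a = b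

/-- A subloop: a subset containing `1` and closed under the product and both divisions. -/
structure Subloop (Q : Type u) [Loop Q] where
  carrier : Set Q
  one_mem' : (1 : Q) ∈ carrier
  mul_mem' : ∀ {a b : Q}, a ∈ carrier → b ∈ carrier → a * b ∈ carrier
  ldiv_mem' : ∀ {a b : Q}, a ∈ carrier → b ∈ carrier → Loop.ldiv a b ∈ carrier
  rdiv_mem' : ∀ {a b : Q}, a ∈ carrier → b ∈ carrier → Loop.rdiv a b ∈ carrier

instance (Q : Type u) [Loop Q] : SetLike (Subloop Q) Q where
  coe := Subloop.carrier
  coe_injective := by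
    rintro ⟨s, _, _, _, _⟩ ⟨t, _, _, _, _⟩ h
    cases h
    rfl

variable {Q : Type u} [Loop Q]

theorem mul_left_cancel' {a b c : Q} (h : a * b = a * c) : b = c := by
  rw [← Loop.ldiv_mul a b, h, Loop.ldiv_mul]

theorem mul_right_cancel' {a b c : Q} (h : b * a = c * a) : b = c := by
  rw [← Loop.mul_rdiv b a, h, Loop.mul_rdiv]

/-- The subloop generated by a set: the intersection of all subloops containing it. -/
def Subloop.closure (s : Set Q) : Subloop Q where
  carrier := {x | ∀ H : Subloop Q, s ⊆ (H : Set Q) → x ∈ H}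
  one_mem' := fun H _ => H.one_mem'
  mul_mem' := fun ha hb H hs => H.mul_mem' (ha H hs) (hb H hs)
  ldiv_mem' := fun ha hb H hs => H.ldiv_mem' (ha H hs) (hb H hs)
  rdiv_mem' := fun ha hb H hs => H.rdiv_mem' (ha H hs) (hb H hs)

/-- The index `|Q : H|`: the number of left cosets `xH`, `x ∈ Q`. -/
noncomputable def Subloop.index (H : Subloop Q) : ℕ :=
  Nat.card (Set.range fun x : Q => (fun h : Q => x * h) '' (H : Set Q))

/-- The associator `(x, y, z)`, the solution `c` of `(x * (y * z)) * c = (x * y) * z`. -/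
def associator (x y z : Q) : Q :=
  Loop.ldiv (x * (y * z)) ((x * y) * z)

variable (Q)

/-- A Moufang loop. -/
def IsMoufang : Prop :=
  ∀ x y z : Q, (x * y) * (z * x) = x * ((y * z) * x)

/-- A conjugacy closed loop (CC-loop): the set of left translations `L x : t ↦ x * t` and the set
of right translations `R x : t ↦ t * x` are each closed under conjugation, that is, for all
`x`, `y` there is `z` with `L x ∘ L y ∘ (L x)⁻¹ = L z` (equivalently `L x ∘ L y = L z ∘ L x`),
and there is `z` with `R x ∘ R y ∘ (R x)⁻¹ = R z`. -/
def IsConjugacyClosed : Prop :=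
  (∀ x y : Q, ∃ z : Q, ∀ t : Q, x * (y * t) = z * (x * t)) ∧
  (∀ x y : Q, ∃ z : Q, ∀ t : Q, (t * y) * x = (t * x) * z)

/-- An extra loop: a loop that is both conjugacy closed and Moufang. -/
def IsExtraLoop : Prop :=
  IsConjugacyClosed Q ∧ IsMoufang Q

/-- `A(Q)`: the subloop generated by all the associators. -/
def associatorSubloop : Subloop Q :=
  Subloop.closure {a | ∃ x y z : Q, a = associator x y z}

/-- The nucleus `N(Q)`: the elements that associate with all pairs of elements, in each of the
three positions. -/
def nucleus : Subloop Q where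
  carrier := {a | (∀ x y : Q, (a * x) * y = a * (x * y)) ∧
    (∀ x y : Q, (x * a) * y = x * (a * y)) ∧ (∀ x y : Q, (x * y) * a = x * (y * a))}
  one_mem' := by simp
  mul_mem' := by
    rintro a b ⟨a1, a2, a3⟩ ⟨b1, b2, b3⟩
    refine ⟨fun x y => ?_, fun x y => ?_, fun x y => ?_⟩
    · rw [a1, a1, b1, a1]
    · rw [← a2, b2, a2, a1]
    · rw [← b3, a3, b3, b3]
  ldiv_mem' := by
    rintro a b ⟨a1, a2, a3⟩ ⟨b1, b2, b3⟩
    have h := Loop.mul_ldiv a b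
    set c := Loop.ldiv a b
    refine ⟨fun x y => ?_, fun x y => ?_, fun x y => ?_⟩
    · apply mul_left_cancel' (a := a)
      rw [← a1, ← a1, ← a1, h, b1]
    · rw [← Loop.rdiv_mul x a, a2, a2, h, b2, ← a1, h]
    · rw [← Loop.rdiv_mul y a, ← a3, a2, a2, h, b3]
  rdiv_mem' := by
    rintro b a ⟨b1, b2, b3⟩ ⟨a1, a2, a3⟩
    have h := Loop.rdiv_mul b a
    set c := Loop.rdiv b a
    refine ⟨fun x y => ?_, fun x y => ?_, fun x y => ?_⟩
    · rw [← Loop.mul_ldiv a x, ← a2, h, a1, ← a2, h, b1]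
    · rw [← Loop.mul_ldiv a y, ← a2, a3, h, ← a2, h, b2]
    · apply mul_right_cancel' (a := a)
      rw [a3, a3, a3, h, b3]

/-- The center `Z(Q)`: the elements of the nucleus that commute with every element. -/
def center : Subloop Q where
  carrier := {a | a ∈ nucleus Q ∧ ∀ x : Q, a * x = x * a}
  one_mem' := ⟨(nucleus Q).one_mem', by simp⟩
  mul_mem' := by
    rintro a b ⟨ha, a4⟩ ⟨hb, b4⟩
    refine ⟨(nucleus Q).mul_mem' ha hb, fun x => ?_⟩
    rw [ha.1, b4, ← ha.1, a4, ha.2.1]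
  ldiv_mem' := by
    rintro a b ⟨ha, a4⟩ ⟨hb, b4⟩
    refine ⟨(nucleus Q).ldiv_mem' ha hb, fun x => ?_⟩
    apply mul_left_cancel' (a := a)
    rw [← ha.1, Loop.mul_ldiv, b4, ← ha.1, a4, ha.2.1, Loop.mul_ldiv]
  rdiv_mem' := by
    rintro b a ⟨hb, b4⟩ ⟨ha, a4⟩
    refine ⟨(nucleus Q).rdiv_mem' hb ha, fun x => ?_⟩
    apply mul_right_cancel' (a := a)
    rw [ha.2.2, ha.2.2, Loop.rdiv_mul, ← a4, ← ha.2.1, Loop.rdiv_mul, b4]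

/-- The congruence on `Q` whose classes are the cosets `xZ(Q)` of the center. -/
def centerCon : Con Q where
  r x y := ∃ z ∈ center Q, y = x * z
  iseqv :=
    { refl := fun x => ⟨1, (center Q).one_mem', by simp⟩
      symm := by
        rintro x _ ⟨z, hz, rfl⟩
        refine ⟨Loop.ldiv z 1, (center Q).ldiv_mem' hz (center Q).one_mem', ?_⟩
        rw [hz.1.2.1, Loop.mul_ldiv, mul_one]
      trans := by
        rintro x _ _ ⟨z, hz, rfl⟩ ⟨w, hw, rfl⟩
        exact ⟨z * w, (center Q).mul_mem' hz hw, hz.1.2.1 _ _⟩ }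
  mul' := by
    rintro x _ y _ ⟨z, hz, rfl⟩ ⟨w, hw, rfl⟩
    refine ⟨z * w, (center Q).mul_mem' hz hw, ?_⟩
    rw [hz.1.2.1, ← hz.1.1, hz.2 y, hz.1.2.1 y w]
    exact (((center Q).mul_mem' hz hw).1.2.2 x y).symm

/-- The quotient `Q / Z(Q)`, whose elements are the cosets of the center, with the product
`xZ(Q) * yZ(Q) = (x * y)Z(Q)`. -/
abbrev CenterQuotient : Type u := (centerCon Q).Quotient

/-- A multiplication is a group if it is the multiplication of some group structure. -/
def IsGroup (M : Type u) [Mul M] : Prop :=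
  ∃ G : Group M, ∀ a b : M, G.mul a b = a * b

end LoopTheory

/-! In an extra loop every square lies in the nucleus N, so N is normal and Q/N is an elementary
abelian 2-group. Associators lie in the centre of N and depend only on the classes of their
arguments mod N. Q acts on this abelian group by conjugation, and the pentagon relation
`assoc_cocycle`, combined with the Moufang and extra identities, shows that the associator is
symmetric, has exponent 2, and is fixed by conjugation by each of its arguments.

The key is `assocComm_rotate`: the commutator c of (x,y,z) with w is invariant under cyclic shifts
of w, x, y, z. If some associator is not central, some c is nontrivial. Each of w, x, y, z then
fixes c and three of the four associators on these elements, and multiplies the fourth by c. Hence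
the four associators and c are independent over F₂, giving 2^5 elements of A(Q), and w, x, y, z are
independent mod N, giving 2^4 cosets. A(Q) is an elementary abelian 2-subgroup of N, so 2^4 · 2^5
divides |Q:N| · |N| = |Q|. -/

namespace LoopTheory

universe u

/-! ### Inverse property, alternativity, and nuclear squares -/

section Moufang

variable {Q : Type u} [Loop Q]

instance : Inv Q := ⟨fun x => Loop.ldiv x 1⟩

theorem mul_inv_self (x : Q) : x * x⁻¹ = 1 := Loop.mul_ldiv x 1

theorem associator_spec (x y z : Q) : (x * y) * z = (x * (y * z)) * associator x y z :=
  (Loop.mul_ldiv _ _).symm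

theorem associator_eq {x y z a : Q} (h : (x * y) * z = (x * (y * z)) * a) :
    associator x y z = a :=
  mul_left_cancel' ((associator_spec x y z).symm.trans h)

namespace IsMoufang

variable (hM : IsMoufang Q)
include hM

theorem flexible (x y : Q) : (x * y) * x = x * (y * x) := by
  simpa using hM x y 1

theorem mul_inv_mul_cancel (x z : Q) : x * (x⁻¹ * z) = z := by
  apply mul_right_cancel' (a := x)
  rw [hM.flexible, ← hM, mul_inv_self, one_mul]

theorem inv_mul_self (x : Q) : x⁻¹ * x = 1 :=
  mul_left_cancel' (a := x) (by rw [hM.mul_inv_mul_cancel, mul_one])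

theorem inv_inv (x : Q) : x⁻¹⁻¹ = x :=
  mul_left_cancel' (a := x⁻¹) (by rw [mul_inv_self, hM.inv_mul_self])

theorem inv_mul_cancel_left (x z : Q) : x⁻¹ * (x * z) = z := by
  simpa only [hM.inv_inv] using hM.mul_inv_mul_cancel x⁻¹ z

theorem inv_mul_cancel_right (x y : Q) : (y * x⁻¹) * x = y := by
  apply mul_left_cancel' (a := x)
  rw [← hM, hM.inv_mul_self, mul_one]

theorem mul_inv_cancel_right (x y : Q) : (y * x) * x⁻¹ = y := by
  simpa only [hM.inv_inv] using hM.inv_mul_cancel_right x⁻¹ y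

theorem mul_inv_rev (x y : Q) : (x * y)⁻¹ = y⁻¹ * x⁻¹ := by
  have h : x⁻¹ = y * (x * y)⁻¹ := by
    have := hM.mul_inv_cancel_right (x * y) x⁻¹
    rwa [hM.inv_mul_cancel_left, eq_comm] at this
  rw [h, hM.inv_mul_cancel_left]

theorem inv_injective {x y : Q} (h : x⁻¹ = y⁻¹) : x = y := by
  rw [← hM.inv_inv x, h, hM.inv_inv]

theorem left_moufang (x u t : Q) : x * (u * (x * t)) = ((x * u) * x) * t := by
  -- This choice of third argument cancels `x * t` on the right and leaves `t⁻¹` as the right factor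
  -- on the left.
  have h := hM x (u * (x * t)) (x * t)⁻¹
  rw [hM.mul_inv_cancel_right, ← hM.flexible] at h
  rw [← h, hM.mul_inv_rev, hM.inv_mul_cancel_right, hM.inv_mul_cancel_right]

theorem left_alternative (x t : Q) : (x * x) * t = x * (x * t) := by
  simpa using (hM.left_moufang x 1 t).symm

theorem right_alternative (x t : Q) : (t * x) * x = t * (x * x) := by
  apply hM.inv_injective
  simp only [hM.mul_inv_rev]
  exact (hM.left_alternative _ _).symm

/-- The inverse property makes the three nuclei coincide: inversion exchanges left and right, and
solving the middle identity for `z` gives the left one for the inverse. -/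
theorem mem_nucleus_of_middle {n : Q} (h : ∀ y z : Q, (y * n) * z = y * (n * z)) :
    n ∈ nucleus Q := by
  have key : ∀ m : Q, (∀ y z : Q, (y * m) * z = y * (m * z)) →
      ∀ y w : Q, m⁻¹ * (y⁻¹ * w) = (m⁻¹ * y⁻¹) * w := by
    intro m hm y w
    have h1 := hm y (m⁻¹ * (y⁻¹ * w))
    rw [hM.mul_inv_mul_cancel, hM.mul_inv_mul_cancel] at h1
    rw [← hM.mul_inv_rev]
    apply mul_left_cancel' (a := y * m)
    rw [h1, hM.mul_inv_mul_cancel]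
  have h' : ∀ y z : Q, (y * n⁻¹) * z = y * (n⁻¹ * z) := by
    intro y z
    apply hM.inv_injective
    simp only [hM.mul_inv_rev, hM.inv_inv]
    exact (h _ _).symm
  refine ⟨fun x y => ?_, h, fun x y => ?_⟩
  · have := key n⁻¹ h' x⁻¹ y
    simpa only [hM.inv_inv] using this.symm
  · apply hM.inv_injective
    simp only [hM.mul_inv_rev]
    have := key n h y x⁻¹
    exact this

end IsMoufang

/-- Conjugacy closure supplies a left translation by some `z`; evaluating at 1 forces `z = x * y`.
-/
theorem IsExtraLoop.mul_mul_mul (hQ : IsExtraLoop Q) (x y t : Q) :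
    (x * y) * (x * t) = x * ((y * x) * t) := by
  obtain ⟨z, hz⟩ := hQ.1.1 x (y * x)
  have h1 := hz 1
  rw [mul_one, mul_one, ← hQ.2.flexible] at h1
  rw [hz t, mul_right_cancel' h1]

theorem IsExtraLoop.sq_mem_nucleus (hQ : IsExtraLoop Q) (x : Q) : x * x ∈ nucleus Q := by
  apply hQ.2.mem_nucleus_of_middle
  intro y s
  apply mul_left_cancel' (a := x)
  rw [hQ.2.left_alternative, hQ.2.left_moufang, hQ.2.flexible, hQ.mul_mul_mul,
    hQ.2.right_alternative]

end Moufang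

/-! ### Normality of the nucleus -/

section Nucleus

variable {Q : Type u} [Loop Q]

theorem nucleus_left {a : Q} (ha : a ∈ nucleus Q) (x y : Q) : (a * x) * y = a * (x * y) :=
  ha.1 x y

theorem nucleus_middle {a : Q} (ha : a ∈ nucleus Q) (x y : Q) : (x * a) * y = x * (a * y) :=
  ha.2.1 x y

theorem nucleus_right {a : Q} (ha : a ∈ nucleus Q) (x y : Q) : (x * y) * a = x * (y * a) :=
  ha.2.2 x y

theorem IsExtraLoop.exists_mul_eq_mul_left (hQ : IsExtraLoop Q) (x : Q) {n : Q}
    (hn : n ∈ nucleus Q) : ∃ p ∈ nucleus Q, x * n = p * x := by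
  -- The square of `x * n` is nuclear, and its last factor `n` can be divided off.
  have h1 : (x * n) * x ∈ nucleus Q := by
    have h := (nucleus Q).rdiv_mem' (hQ.sq_mem_nucleus (x * n)) hn
    rwa [← nucleus_right hn, Loop.mul_rdiv] at h
  have h2 := hQ.sq_mem_nucleus x⁻¹
  refine ⟨_, (nucleus Q).mul_mem' h1 h2, ?_⟩
  rw [nucleus_left h1, hQ.2.inv_mul_cancel_right, hQ.2.mul_inv_cancel_right]

theorem IsExtraLoop.exists_mul_eq_mul_right (hQ : IsExtraLoop Q) (x : Q) {n : Q}
    (hn : n ∈ nucleus Q) : ∃ p ∈ nucleus Q, n * x = x * p := by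
  have h1 : (x * n) * x ∈ nucleus Q := by
    have h := (nucleus Q).rdiv_mem' (hQ.sq_mem_nucleus (x * n)) hn
    rwa [← nucleus_right hn, Loop.mul_rdiv] at h
  have h2 := hQ.sq_mem_nucleus x⁻¹
  refine ⟨_, (nucleus Q).mul_mem' h2 h1, ?_⟩
  rw [← nucleus_middle h2, hQ.2.mul_inv_mul_cancel, hQ.2.flexible, hQ.2.inv_mul_cancel_left]

instance : Group (nucleus Q) where
  mul a b := ⟨a * b, (nucleus Q).mul_mem' a.2 b.2⟩
  one := ⟨1, (nucleus Q).one_mem'⟩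
  inv a := ⟨Loop.rdiv 1 a, (nucleus Q).rdiv_mem' (nucleus Q).one_mem' a.2⟩
  mul_assoc a b c := Subtype.ext (nucleus_left a.2 _ _)
  one_mul a := Subtype.ext (one_mul _)
  mul_one a := Subtype.ext (mul_one _)
  inv_mul_cancel a := Subtype.ext (Loop.rdiv_mul _ _)

end Nucleus

/-! ### The elementary abelian quotient by the nucleus, and associators modulo it -/

section Quotient

variable {Q : Type u} [Loop Q]

/-- The congruence of an extra loop whose classes are the cosets of the nucleus. -/
def IsExtraLoop.nucleusCon (hQ : IsExtraLoop Q) : Con Q where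
  r x y := ∃ n ∈ nucleus Q, y = x * n
  iseqv :=
    { refl := fun x => ⟨1, (nucleus Q).one_mem', by simp⟩
      symm := by
        rintro x _ ⟨n, hn, rfl⟩
        refine ⟨Loop.ldiv n 1, (nucleus Q).ldiv_mem' hn (nucleus Q).one_mem', ?_⟩
        rw [nucleus_middle hn, Loop.mul_ldiv, mul_one]
      trans := by
        rintro x _ _ ⟨n, hn, rfl⟩ ⟨m, hm, rfl⟩
        exact ⟨n * m, (nucleus Q).mul_mem' hn hm, nucleus_middle hn _ _⟩ }
  mul' := by
    rintro x _ y _ ⟨n, hn, rfl⟩ ⟨m, hm, rfl⟩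
    obtain ⟨p, hp, h⟩ := hQ.exists_mul_eq_mul_right y hn
    refine ⟨p * m, (nucleus Q).mul_mem' hp hm, ?_⟩
    rw [nucleus_middle hn, ← nucleus_left hn, h, nucleus_right ((nucleus Q).mul_mem' hp hm),
      nucleus_middle hp]

/-- The quotient of an extra loop by its nucleus. -/
abbrev IsExtraLoop.NucleusQuotient (hQ : IsExtraLoop Q) : Type u := hQ.nucleusCon.Quotient

variable (hQ : IsExtraLoop Q)

namespace IsExtraLoop

theorem nucleusQuotient_eq {x y : Q} :
    (x : hQ.NucleusQuotient) = y ↔ ∃ n ∈ nucleus Q, y = x * n :=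
  Con.eq _

theorem nucleusQuotient_eq_one {n : Q} (hn : n ∈ nucleus Q) : (n : hQ.NucleusQuotient) = 1 :=
  Eq.symm (hQ.nucleusQuotient_eq.2 ⟨n, hn, (one_mul n).symm⟩)

theorem nucleusQuotient_mul_self (x : hQ.NucleusQuotient) : x * x = 1 := by
  induction x using Con.induction_on with
  | H x => exact hQ.nucleusQuotient_eq_one (hQ.sq_mem_nucleus x)

theorem nucleusQuotient_mul_mul_cancel_left (x y : hQ.NucleusQuotient) : x * (x * y) = y := by
  have h : (x * x) * y = x * (x * y) := by
    induction x using Con.induction_on with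
    | H x =>
      induction y using Con.induction_on with
      | H y => exact congrArg ((↑) : Q → hQ.NucleusQuotient) (hQ.2.left_alternative x y)
  rw [← h, nucleusQuotient_mul_self, one_mul]

theorem nucleusQuotient_mul_mul_cancel_right (x y : hQ.NucleusQuotient) : (y * x) * x = y := by
  have h : (y * x) * x = y * (x * x) := by
    induction x using Con.induction_on with
    | H x =>
      induction y using Con.induction_on with
      | H y => exact congrArg ((↑) : Q → hQ.NucleusQuotient) (hQ.2.right_alternative x y)
  rw [h, nucleusQuotient_mul_self, mul_one]

theorem nucleusQuotient_mul_comm (x y : hQ.NucleusQuotient) : x * y = y * x := by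
  have h1 : (x * y) * y = x := hQ.nucleusQuotient_mul_mul_cancel_right y x
  have h2 : (x * y) * x = y := by
    simpa only [h1] using hQ.nucleusQuotient_mul_mul_cancel_left (x * y) y
  conv_rhs => rw [← h2]
  rw [hQ.nucleusQuotient_mul_mul_cancel_right]

/-- A commutative Moufang loop of exponent 2 is a group: in the Moufang identity for `y`, `x`, `y *
z` the repeated `y` cancels. -/
theorem nucleusQuotient_mul_assoc (x y z : hQ.NucleusQuotient) : (x * y) * z = x * (y * z) := by
  have hM : ∀ x y z : hQ.NucleusQuotient, (x * y) * (z * x) = x * ((y * z) * x) := by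
    intro x y z
    induction x using Con.induction_on with
    | H x =>
      induction y using Con.induction_on with
      | H y =>
        induction z using Con.induction_on with
        | H z => exact congrArg ((↑) : Q → hQ.NucleusQuotient) (hQ.2 x y z)
  have h := hM y x (y * z)
  rw [hQ.nucleusQuotient_mul_comm (y * z) y, hQ.nucleusQuotient_mul_mul_cancel_left,
    hQ.nucleusQuotient_mul_comm _ y, hQ.nucleusQuotient_mul_mul_cancel_left,
    hQ.nucleusQuotient_mul_comm y x] at h
  exact h

instance : CommGroup hQ.NucleusQuotient where
  mul_assoc := hQ.nucleusQuotient_mul_assoc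
  one_mul := one_mul
  mul_one := mul_one
  inv x := x
  inv_mul_cancel := hQ.nucleusQuotient_mul_self
  mul_comm := hQ.nucleusQuotient_mul_comm

include hQ

theorem associator_mem_nucleus (x y z : Q) : associator x y z ∈ nucleus Q := by
  have h : ((x * (y * z) : Q) : hQ.NucleusQuotient) = ((x * y) * z : Q) :=
    (hQ.nucleusQuotient_mul_assoc x y z).symm
  obtain ⟨n, hn, h⟩ := hQ.nucleusQuotient_eq.1 h
  rwa [associator_eq h]

/-- With `n` the conjugate of `m` across `y * z`, evaluate `((x * n) * y) * z` twice. Moving `n`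
right puts `m` after the associator; moving it left past `x`, then back across `x * (y * z)`, puts
`m` before it. -/
theorem associator_mul_comm (x y z : Q) {m : Q} (hm : m ∈ nucleus Q) :
    associator x y z * m = m * associator x y z := by
  obtain ⟨n, hn, h⟩ := hQ.exists_mul_eq_mul_left (y * z) hm
  obtain ⟨p, hp, hxn⟩ := hQ.exists_mul_eq_mul_left x hn
  obtain ⟨n₁, hn₁, hny⟩ := hQ.exists_mul_eq_mul_right y hn
  obtain ⟨n₂, hn₂, hnz⟩ := hQ.exists_mul_eq_mul_right z hn₁
  have h2 : n₂ = m := by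
    apply mul_left_cancel' (a := y * z)
    rw [h, ← nucleus_left hn, hny, nucleus_middle hn₁, hnz, nucleus_right hn₂]
  subst h2
  apply mul_left_cancel' (a := x * (y * z))
  calc (x * (y * z)) * (associator x y z * n₂)
      = ((x * n) * y) * z := by
        rw [nucleus_middle hn, hny, ← nucleus_right hn₁, nucleus_middle hn₁, hnz,
          ← nucleus_right hn₂, ← nucleus_right hn₂,
          associator_spec x y z]
    _ = (x * (y * z)) * (n₂ * associator x y z) := by
        rw [hxn, nucleus_left hp, nucleus_left hp, associator_spec, ← nucleus_left hp,
          ← nucleus_left hp, ← hxn, nucleus_middle hn, ← h, ← nucleus_right hn₂,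
          nucleus_middle hn₂]

theorem associator_congr_left {x x' : Q} (h : (x : hQ.NucleusQuotient) = x') (y z : Q) :
    associator x y z = associator x' y z := by
  obtain ⟨n, hn, rfl⟩ := hQ.nucleusQuotient_eq.1 h
  obtain ⟨p, hp, hxn⟩ := hQ.exists_mul_eq_mul_left x hn
  refine (associator_eq ?_).symm
  rw [hxn, nucleus_left hp, nucleus_left hp, associator_spec, ← nucleus_left hp, nucleus_left hp x]

theorem associator_congr_right {z z' : Q} (h : (z : hQ.NucleusQuotient) = z') (x y : Q) :
    associator x y z = associator x y z' := by
  obtain ⟨n, hn, rfl⟩ := hQ.nucleusQuotient_eq.1 h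
  refine (associator_eq ?_).symm
  rw [← nucleus_right hn, associator_spec x y z, nucleus_right hn, hQ.associator_mul_comm x y z hn,
    ← nucleus_middle hn, nucleus_right hn, nucleus_right hn]

theorem associator_congr_middle {y y' : Q} (h : (y : hQ.NucleusQuotient) = y') (x z : Q) :
    associator x y z = associator x y' z := by
  obtain ⟨n, hn, rfl⟩ := hQ.nucleusQuotient_eq.1 h
  have hz : (z : hQ.NucleusQuotient) = ((n * z : Q)) := by
    change (z : hQ.NucleusQuotient) = (n : hQ.NucleusQuotient) * z
    rw [hQ.nucleusQuotient_eq_one hn, one_mul]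
  rw [hQ.associator_congr_right hz]
  refine (associator_eq ?_).symm
  rw [← nucleus_right hn, nucleus_middle hn, associator_spec x y (n * z), nucleus_middle hn]

theorem associator_congr {x x' y y' z z' : Q} (hx : (x : hQ.NucleusQuotient) = x')
    (hy : (y : hQ.NucleusQuotient) = y') (hz : (z : hQ.NucleusQuotient) = z') :
    associator x y z = associator x' y' z' := by
  rw [hQ.associator_congr_left hx, hQ.associator_congr_middle hy, hQ.associator_congr_right hz]

end IsExtraLoop

end Quotient

/-! ### The centre of the nucleus as an additive group -/

section NucleusCenter

variable {Q : Type u} [Loop Q]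

variable (Q) in
/-- The centre of the nucleus, written additively. -/
@[ext]
structure NucleusCenter : Type u where
  val : Q
  mem : val ∈ nucleus Q
  comm : ∀ n ∈ nucleus Q, val * n = n * val

namespace NucleusCenter

instance : Add (NucleusCenter Q) where
  add a b := ⟨a.1 * b.1, (nucleus Q).mul_mem' a.mem b.mem, fun n hn => by
    rw [nucleus_left a.mem, b.comm n hn, ← nucleus_left a.mem, a.comm n hn, nucleus_left hn]⟩

instance : Zero (NucleusCenter Q) where
  zero := ⟨1, (nucleus Q).one_mem', fun n _ => by rw [one_mul, mul_one]⟩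

instance : Neg (NucleusCenter Q) where
  neg a := ⟨Loop.rdiv 1 a.1, (nucleus Q).rdiv_mem' (nucleus Q).one_mem' a.mem, fun n hn => by
    apply mul_right_cancel' (a := a.1)
    rw [nucleus_right a.mem, nucleus_right a.mem, ← a.comm n hn, Loop.rdiv_mul, mul_one,
      ← nucleus_middle a.mem, Loop.rdiv_mul, one_mul]⟩

@[simp] theorem val_add (a b : NucleusCenter Q) : (a + b).1 = a.1 * b.1 := rfl

@[simp] theorem val_zero : (0 : NucleusCenter Q).1 = 1 := rfl

@[simp] theorem val_neg (a : NucleusCenter Q) : (-a).1 = Loop.rdiv 1 a.1 := rfl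

instance : AddCommGroup (NucleusCenter Q) where
  add_assoc a b c := NucleusCenter.ext (nucleus_left a.mem _ _)
  zero_add a := NucleusCenter.ext (one_mul _)
  add_zero a := NucleusCenter.ext (mul_one _)
  neg_add_cancel a := NucleusCenter.ext (Loop.rdiv_mul _ _)
  add_comm a b := NucleusCenter.ext (a.comm _ b.mem)
  nsmul := nsmulRec
  zsmul := zsmulRec

variable (Q) in
/-- The elements of the centre of the nucleus that lie in the associator subloop. -/
def associatorSubgroup : AddSubgroup (NucleusCenter Q) where
  carrier := {a | a.1 ∈ associatorSubloop Q}
  zero_mem' := (associatorSubloop Q).one_mem'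
  add_mem' ha hb := (associatorSubloop Q).mul_mem' ha hb
  neg_mem' ha := (associatorSubloop Q).rdiv_mem' (associatorSubloop Q).one_mem' ha

variable (Q) in
/-- The elements of exponent two in the centre of the nucleus form a subloop. -/
def twoTorsion : Subloop Q where
  carrier := {a | ∃ k : NucleusCenter Q, k.1 = a ∧ k + k = 0}
  one_mem' := ⟨0, rfl, add_zero 0⟩
  mul_mem' := by
    rintro _ _ ⟨k, rfl, hk⟩ ⟨l, rfl, hl⟩
    exact ⟨k + l, rfl, by rw [add_add_add_comm, hk, hl, add_zero]⟩
  ldiv_mem' := by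
    rintro _ _ ⟨k, rfl, hk⟩ ⟨l, rfl, hl⟩
    -- In exponent two, dividing by `k` is the same as multiplying by it.
    refine ⟨k + l, mul_left_cancel' (a := k.1) ?_, by rw [add_add_add_comm, hk, hl, add_zero]⟩
    rw [Loop.mul_ldiv, ← NucleusCenter.val_add, ← add_assoc, hk, zero_add]
  rdiv_mem' := by
    rintro _ _ ⟨k, rfl, hk⟩ ⟨l, rfl, hl⟩
    refine ⟨k + l, mul_right_cancel' (a := l.1) ?_, by rw [add_add_add_comm, hk, hl, add_zero]⟩
    rw [Loop.rdiv_mul, ← NucleusCenter.val_add, add_assoc, hl, add_zero]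

end NucleusCenter

end NucleusCenter

/-! ### Conjugation action and symmetries of the associator -/

namespace IsExtraLoop

variable {Q : Type u} [Loop Q] (hQ : IsExtraLoop Q)
include hQ

theorem ldiv_mul_mem (z : Q) {a : Q} (ha : a ∈ nucleus Q) :
    Loop.ldiv z (a * z) ∈ nucleus Q := by
  obtain ⟨p, hp, h⟩ := hQ.exists_mul_eq_mul_right z ha
  rwa [h, Loop.ldiv_mul]

/-- Conjugation by `z` on the centre of the nucleus. -/
def conj (z : Q) : NucleusCenter Q →+ NucleusCenter Q :=
  AddMonoidHom.mk' (fun a => ⟨Loop.ldiv z (a.1 * z), hQ.ldiv_mul_mem z a.mem, fun n hn => by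
      obtain ⟨p, hp, h⟩ := hQ.exists_mul_eq_mul_left z hn
      have hb := hQ.ldiv_mul_mem z a.mem
      apply mul_left_cancel' (a := z)
      rw [← nucleus_right hn, Loop.mul_ldiv, nucleus_right hn, h, ← nucleus_left a.mem,
        a.comm p hp, nucleus_left hp, ← nucleus_middle hn, h, nucleus_left hp, Loop.mul_ldiv]⟩)
    fun a b => NucleusCenter.ext <| by
      have hb := hQ.ldiv_mul_mem z b.mem
      apply mul_left_cancel' (a := z)
      simp only [NucleusCenter.val_add]
      rw [Loop.mul_ldiv, ← nucleus_right hb, Loop.mul_ldiv, nucleus_right hb, Loop.mul_ldiv,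
        nucleus_left a.mem]

theorem mul_conj (z : Q) (a : NucleusCenter Q) : z * (hQ.conj z a).1 = a.1 * z :=
  Loop.mul_ldiv _ _

theorem conj_eq {z : Q} {a b : NucleusCenter Q} (h : z * b.1 = a.1 * z) : hQ.conj z a = b :=
  NucleusCenter.ext (mul_left_cancel' ((hQ.mul_conj z a).trans h.symm))

theorem conj_mul (x y : Q) (a : NucleusCenter Q) :
    hQ.conj (x * y) a = hQ.conj y (hQ.conj x a) := by
  apply hQ.conj_eq
  rw [nucleus_right (hQ.conj y _).mem, mul_conj, ← nucleus_middle (hQ.conj x a).mem, mul_conj,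
    nucleus_left a.mem]

theorem conj_of_mem_nucleus {n : Q} (hn : n ∈ nucleus Q) (a : NucleusCenter Q) :
    hQ.conj n a = a :=
  hQ.conj_eq (a.comm n hn).symm

theorem conj_one (a : NucleusCenter Q) : hQ.conj 1 a = a :=
  hQ.conj_of_mem_nucleus (nucleus Q).one_mem' a

theorem conj_congr {x y : Q} (h : (x : hQ.NucleusQuotient) = y) : hQ.conj x = hQ.conj y := by
  obtain ⟨n, hn, rfl⟩ := hQ.nucleusQuotient_eq.1 h
  ext1 a
  rw [conj_mul, hQ.conj_of_mem_nucleus hn]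

theorem conj_conj (x : Q) (a : NucleusCenter Q) : hQ.conj x (hQ.conj x a) = a := by
  rw [← conj_mul, hQ.conj_of_mem_nucleus (hQ.sq_mem_nucleus x)]

/-- The associator as an element of the centre of the nucleus. -/
def assoc (x y z : Q) : NucleusCenter Q :=
  ⟨associator x y z, hQ.associator_mem_nucleus x y z, fun _ hn => hQ.associator_mul_comm x y z hn⟩

theorem assoc_spec (x y z : Q) : (x * y) * z = (x * (y * z)) * (hQ.assoc x y z).1 :=
  associator_spec x y z

theorem assoc_eq {x y z : Q} {a : NucleusCenter Q} (h : (x * y) * z = (x * (y * z)) * a.1) :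
    hQ.assoc x y z = a :=
  NucleusCenter.ext (associator_eq h)

theorem assoc_congr {x x' y y' z z' : Q} (hx : (x : hQ.NucleusQuotient) = x')
    (hy : (y : hQ.NucleusQuotient) = y') (hz : (z : hQ.NucleusQuotient) = z') :
    hQ.assoc x y z = hQ.assoc x' y' z' :=
  NucleusCenter.ext (hQ.associator_congr hx hy hz)

theorem mk_mul_comm (x y : Q) : ((x * y : Q) : hQ.NucleusQuotient) = (y * x : Q) :=
  hQ.nucleusQuotient_mul_comm x y

theorem mk_mul_mul_cancel_right (x y : Q) : (((y * x) * x : Q) : hQ.NucleusQuotient) = y :=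
  hQ.nucleusQuotient_mul_mul_cancel_right x y

theorem mk_mul_self (x : Q) : ((x * x : Q) : hQ.NucleusQuotient) = (1 : Q) :=
  hQ.nucleusQuotient_mul_self x

theorem assoc_one_left (y z : Q) : hQ.assoc 1 y z = 0 := hQ.assoc_eq (by simp)

theorem assoc_one_right (x y : Q) : hQ.assoc x y 1 = 0 := hQ.assoc_eq (by simp)

theorem assoc_self_left (x y : Q) : hQ.assoc x x y = 0 :=
  hQ.assoc_eq (by simp [hQ.2.left_alternative])

theorem assoc_self_right (x y : Q) : hQ.assoc x y y = 0 :=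
  hQ.assoc_eq (by simp [hQ.2.right_alternative])

/-- Both sides compare `((w * x) * y) * z` with `w * (x * (y * z))`; the conjugation arises from
carrying the associator of `w, x, y` past `z`. -/
theorem assoc_cocycle (w x y z : Q) :
    hQ.assoc (w * x) y z + hQ.assoc w x (y * z) =
      hQ.assoc x y z + hQ.assoc w (x * y) z + hQ.conj z (hQ.assoc w x y) := by
  apply NucleusCenter.ext
  apply mul_left_cancel' (a := w * (x * (y * z)))
  have e1 : ((w * x) * y) * z = (w * (x * (y * z))) *
      (hQ.assoc (w * x) y z + hQ.assoc w x (y * z)).1 := by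
    rw [add_comm, NucleusCenter.val_add, ← nucleus_middle (hQ.assoc w x (y * z)).mem,
      ← hQ.assoc_spec w x, ← hQ.assoc_spec (w * x)]
  rw [← e1, hQ.assoc_spec w x y, nucleus_middle (hQ.assoc w x y).mem, ← hQ.mul_conj,
    ← nucleus_right (hQ.conj z _).mem, hQ.assoc_spec w (x * y) z, hQ.assoc_spec x y z,
    ← nucleus_right (hQ.assoc x y z).mem]
  simp only [NucleusCenter.val_add]
  rw [nucleus_middle (hQ.assoc x y z).mem, nucleus_middle
    ((nucleus Q).mul_mem' (hQ.assoc x y z).mem (hQ.assoc w (x * y) z).mem)]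

theorem assoc_mul_left_middle (x y z : Q) : hQ.assoc x (x * y) z = -hQ.assoc x y z := by
  have h := hQ.assoc_cocycle x x y z
  rw [hQ.assoc_congr (hQ.mk_mul_self x) rfl rfl, assoc_one_left, assoc_self_left, assoc_self_left,
    map_zero, add_zero, add_zero] at h
  exact (neg_eq_of_add_eq_zero_right h.symm).symm

theorem assoc_mul_right_middle (x y z : Q) :
    hQ.assoc x (y * z) z = -hQ.conj z (hQ.assoc x y z) := by
  have h := hQ.assoc_cocycle x y z z
  rw [hQ.assoc_congr rfl rfl (hQ.mk_mul_self z), assoc_one_right, assoc_self_right,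
    assoc_self_right, add_zero, zero_add] at h
  exact (neg_eq_of_add_eq_zero_left h.symm).symm

/-- The extra identity `mul_mul_mul` and flexibility turn one defining equation into the other. -/
theorem assoc_mul_left_comm (x y z : Q) : hQ.assoc (x * y) x z = hQ.assoc x (y * x) z := by
  apply hQ.assoc_eq
  apply mul_right_cancel' (a := Loop.ldiv (hQ.assoc x (y * x) z).1 1)
  have h := hQ.assoc_spec x (y * x) z
  rw [← hQ.mul_mul_mul, ← hQ.2.flexible] at h
  rw [h]

theorem assoc_swap_left (x y z : Q) : hQ.assoc x y z = -hQ.assoc y x z := by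
  have h1 : hQ.assoc (x * y) x z = -hQ.assoc x y z := by
    rw [assoc_mul_left_comm, hQ.assoc_congr rfl (hQ.mk_mul_comm y x) rfl, assoc_mul_left_middle]
  have h2 : hQ.assoc (x * y) x z = hQ.assoc y x z := by
    have h := hQ.assoc_mul_left_middle (x * y) y z
    have h' : hQ.assoc (x * y) y z = -hQ.assoc y x z := by
      rw [hQ.assoc_congr (hQ.mk_mul_comm x y) rfl rfl, assoc_mul_left_comm,
        hQ.assoc_congr rfl (hQ.mk_mul_comm x y) rfl, assoc_mul_left_middle]
    rwa [hQ.assoc_congr rfl (hQ.mk_mul_mul_cancel_right y x) rfl, h', neg_neg] at h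
  rw [← h2, h1, neg_neg]

theorem assoc_mul_outer (x y z : Q) : hQ.assoc (x * y) z x = hQ.conj x (hQ.assoc x y z) := by
  apply hQ.assoc_eq
  have h := hQ.2 x y z
  rw [← hQ.2.flexible] at h
  rw [h, nucleus_right (hQ.conj x _).mem, mul_conj]
  rw [hQ.assoc_spec x y z, nucleus_middle (hQ.assoc x y z).mem]

theorem assoc_reverse (x y z : Q) : hQ.assoc x y z = hQ.assoc z y x := by
  have h : hQ.conj x (hQ.assoc x y z) = hQ.conj x (hQ.assoc z y x) := by
    rw [← assoc_mul_outer, assoc_swap_left, hQ.assoc_congr rfl (hQ.mk_mul_comm x y) rfl,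
      assoc_mul_right_middle, neg_neg]
  rw [← hQ.conj_conj x (hQ.assoc x y z), h, conj_conj]

theorem assoc_swap_right (x y z : Q) : hQ.assoc x y z = -hQ.assoc x z y := by
  rw [assoc_reverse, assoc_swap_left, assoc_reverse]

/-- Reversal of the arguments changes nothing, yet it is a product of three adjacent transpositions,
each contributing a sign. -/
theorem neg_assoc (x y z : Q) : -hQ.assoc x y z = hQ.assoc x y z := by
  conv_rhs => rw [assoc_reverse, assoc_swap_left, assoc_swap_right, assoc_swap_left]
  simp

theorem assoc_right_comm (x y z : Q) : hQ.assoc x y z = hQ.assoc x z y := by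
  rw [assoc_swap_right, neg_assoc]

theorem conj_right_assoc (x y z : Q) : hQ.conj z (hQ.assoc x y z) = hQ.assoc x y z := by
  rw [← neg_neg (hQ.conj z _), ← assoc_mul_right_middle, assoc_reverse,
    hQ.assoc_congr rfl (hQ.mk_mul_comm y z) rfl, assoc_mul_left_middle, neg_neg, assoc_reverse]

theorem conj_left_assoc (x y z : Q) : hQ.conj x (hQ.assoc x y z) = hQ.assoc x y z := by
  rw [assoc_reverse, conj_right_assoc]

theorem conj_middle_assoc (x y z : Q) : hQ.conj y (hQ.assoc x y z) = hQ.assoc x y z := by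
  rw [assoc_right_comm, conj_right_assoc]

/-- The commutator of the associator `(x, y, z)` and `w`. -/
def assocComm (w x y z : Q) : NucleusCenter Q :=
  hQ.assoc x y z + hQ.conj w (hQ.assoc x y z)

theorem conj_assoc (w x y z : Q) :
    hQ.conj w (hQ.assoc x y z) = hQ.assoc x y z + hQ.assocComm w x y z := by
  rw [assocComm, ← add_assoc]
  nth_rw 2 [← neg_assoc]
  simp

end IsExtraLoop

namespace IsExtraLoop

variable {Q : Type u} [Loop Q] (hQ : IsExtraLoop Q)

/-! ### Cyclic invariance of the commutator -/

section Commutator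

include hQ

theorem assocComm_rotate (w x y z : Q) : hQ.assocComm w x y z = hQ.assocComm z w x y := by
  -- Reversal symmetry identifies the left sides of the two cocycle relations and their middle
  -- terms; what survives is the equality of the two commutators, up to signs that exponent two
  -- removes.
  have h₁ := hQ.assoc_cocycle w x y z
  have h₂ := hQ.assoc_cocycle z y x w
  rw [hQ.assoc_reverse w (x * y) z, hQ.assoc_congr rfl (hQ.mk_mul_comm x y) rfl,
    hQ.assoc_reverse w x (y * z), hQ.assoc_congr (hQ.mk_mul_comm y z) rfl rfl] at h₁
  have e : hQ.assoc (w * x) y z = hQ.assoc z y (x * w) := by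
    rw [assoc_reverse, hQ.assoc_congr rfl rfl (hQ.mk_mul_comm w x)]
  rw [e, add_comm, h₂, hQ.assoc_reverse y x w, hQ.assoc_reverse z y x] at h₁
  have n₁ := hQ.neg_assoc x y z
  have n₂ := hQ.neg_assoc w x y
  rw [assocComm, assocComm]
  grind

theorem conj_assocComm_self (w x y z : Q) :
    hQ.conj w (hQ.assocComm w x y z) = hQ.assocComm w x y z := by
  rw [assocComm, map_add, conj_conj, add_comm]

theorem assocComm_rotate' (w x y z : Q) : hQ.assocComm w x y z = hQ.assocComm x y z w := by
  rw [hQ.assocComm_rotate x, hQ.assocComm_rotate w, hQ.assocComm_rotate z]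

theorem conj_assocComm (w x y z : Q) :
    (hQ.conj w (hQ.assocComm w x y z) = hQ.assocComm w x y z ∧
      hQ.conj x (hQ.assocComm w x y z) = hQ.assocComm w x y z) ∧
    hQ.conj y (hQ.assocComm w x y z) = hQ.assocComm w x y z ∧
      hQ.conj z (hQ.assocComm w x y z) = hQ.assocComm w x y z := by
  refine ⟨⟨hQ.conj_assocComm_self w x y z, ?_⟩, ?_, ?_⟩
  · rw [hQ.assocComm_rotate' w, conj_assocComm_self]
  · rw [hQ.assocComm_rotate' w, hQ.assocComm_rotate' x, conj_assocComm_self]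
  · rw [hQ.assocComm_rotate w, conj_assocComm_self]

end Commutator

/-! ### Coefficients and exponents in F₂ -/

section Boolean

/-- `a` if `b` holds, and `0` otherwise. -/
def indicator (b : Bool) (a : NucleusCenter Q) : NucleusCenter Q := if b then a else 0

/-- `x` if `b` holds, and `1` otherwise. -/
def select (b : Bool) (x : Q) : Q := if b then x else 1

theorem indicator_inj {a : NucleusCenter Q} (ha : a ≠ 0) {b b' : Bool}
    (h : indicator b a = indicator b' a) : b = b' := by
  cases b <;> cases b' <;> simp_all [indicator]

theorem conj_indicator (z : Q) (b : Bool) (a : NucleusCenter Q) :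
    hQ.conj z (indicator b a) = indicator b (hQ.conj z a) := by
  cases b <;> simp [indicator]

theorem indicator_add (b : Bool) (a a' : NucleusCenter Q) :
    indicator b (a + a') = indicator b a + indicator b a' := by
  cases b <;> simp [indicator]

theorem conj_select_of_fixed {x : Q} {a : NucleusCenter Q} (h : hQ.conj x a = a) (b : Bool) :
    hQ.conj (select b x) a = a := by
  cases b
  · exact hQ.conj_one a
  · exact h

theorem conj_select_of_add {x : Q} {a c : NucleusCenter Q} (h : hQ.conj x a = a + c) (b : Bool) :
    hQ.conj (select b x) a = a + indicator b c := by
  cases b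
  · exact (hQ.conj_one a).trans (add_zero a).symm
  · exact h

end Boolean

/-! ### Independence and counting -/

section Counting

/-- The combination of the four associators of `w, x, y, z` and of their common commutator
given by a bit vector. -/
def combination (w x y z : Q) (e : Bool × Bool × Bool × Bool × Bool) : NucleusCenter Q :=
  indicator e.1 (hQ.assoc x y z) + (indicator e.2.1 (hQ.assoc y z w) +
    (indicator e.2.2.1 (hQ.assoc z w x) + (indicator e.2.2.2.1 (hQ.assoc w x y) +
      indicator e.2.2.2.2 (hQ.assocComm w x y z))))

theorem combination_injective {w x y z : Q} (hc : hQ.assocComm w x y z ≠ 0) :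
    Function.Injective (hQ.combination w x y z) := by
  have r₁ : hQ.assocComm x y z w = hQ.assocComm w x y z := (hQ.assocComm_rotate' w x y z).symm
  have r₂ : hQ.assocComm y z w x = hQ.assocComm w x y z := by rw [← assocComm_rotate', r₁]
  have r₃ : hQ.assocComm z w x y = hQ.assocComm w x y z := (hQ.assocComm_rotate w x y z).symm
  obtain ⟨⟨c₁, c₂⟩, c₃, c₄⟩ := hQ.conj_assocComm w x y z
  -- Conjugation by each of the four elements reads off one of the first four bits as a multiple of
  -- the commutator.
  have k₁ : ∀ e, hQ.conj w (hQ.combination w x y z e) =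
      hQ.combination w x y z e + indicator e.1 (hQ.assocComm w x y z) := fun e => by
    simp only [combination, map_add, conj_indicator, conj_left_assoc, conj_middle_assoc,
      conj_right_assoc, c₁, hQ.conj_assoc w x y z, indicator_add]
    abel
  have k₂ : ∀ e, hQ.conj x (hQ.combination w x y z e) =
      hQ.combination w x y z e + indicator e.2.1 (hQ.assocComm w x y z) := fun e => by
    simp only [combination, map_add, conj_indicator, conj_left_assoc, conj_middle_assoc,
      conj_right_assoc, c₂, hQ.conj_assoc x y z w, r₁, indicator_add]
    abel
  have k₃ : ∀ e, hQ.conj y (hQ.combination w x y z e) =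
      hQ.combination w x y z e + indicator e.2.2.1 (hQ.assocComm w x y z) := fun e => by
    simp only [combination, map_add, conj_indicator, conj_left_assoc, conj_middle_assoc,
      conj_right_assoc, c₃, hQ.conj_assoc y z w x, r₂, indicator_add]
    abel
  have k₄ : ∀ e, hQ.conj z (hQ.combination w x y z e) =
      hQ.combination w x y z e + indicator e.2.2.2.1 (hQ.assocComm w x y z) := fun e => by
    simp only [combination, map_add, conj_indicator, conj_left_assoc, conj_middle_assoc,
      conj_right_assoc, c₄, hQ.conj_assoc z w x y, r₃, indicator_add]
    abel
  intro e e' h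
  have h₁ : e.1 = e'.1 := indicator_inj hc (add_left_cancel ((k₁ e).symm.trans (h ▸ k₁ e')))
  have h₂ : e.2.1 = e'.2.1 := indicator_inj hc (add_left_cancel ((k₂ e).symm.trans (h ▸ k₂ e')))
  have h₃ : e.2.2.1 = e'.2.2.1 :=
    indicator_inj hc (add_left_cancel ((k₃ e).symm.trans (h ▸ k₃ e')))
  have h₄ : e.2.2.2.1 = e'.2.2.2.1 :=
    indicator_inj hc (add_left_cancel ((k₄ e).symm.trans (h ▸ k₄ e')))
  have h₅ : e.2.2.2.2 = e'.2.2.2.2 := by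
    simp only [combination, h₁, h₂, h₃, h₄, add_right_inj] at h
    exact indicator_inj hc h
  exact Prod.ext h₁ (Prod.ext h₂ (Prod.ext h₃ (Prod.ext h₄ h₅)))

theorem select_injective {w x y z : Q} (hc : hQ.assocComm w x y z ≠ 0) :
    Function.Injective fun e : Bool × Bool × Bool × Bool =>
      ((select e.1 w * (select e.2.1 x * (select e.2.2.1 y * select e.2.2.2 z)) : Q) :
        hQ.NucleusQuotient) := by
  have r₁ : hQ.assocComm x y z w = hQ.assocComm w x y z := (hQ.assocComm_rotate' w x y z).symm
  have r₂ : hQ.assocComm y z w x = hQ.assocComm w x y z := by rw [← assocComm_rotate', r₁]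
  have r₃ : hQ.assocComm z w x y = hQ.assocComm w x y z := (hQ.assocComm_rotate w x y z).symm
  obtain ⟨⟨c₁, c₂⟩, c₃, c₄⟩ := hQ.conj_assocComm w x y z
  intro e e' h
  -- Equal cosets conjugate alike, and the effect on each of the four associators reveals one
  -- exponent.
  have hconj := hQ.conj_congr h
  have l := hQ.conj_left_assoc
  have m := hQ.conj_middle_assoc
  have r := hQ.conj_right_assoc
  have f₁ := hQ.conj_assoc w x y z
  have f₂ := hQ.conj_assoc x y z w
  have f₃ := hQ.conj_assoc y z w x
  have f₄ := hQ.conj_assoc z w x y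
  rw [r₁] at f₂
  rw [r₂] at f₃
  rw [r₃] at f₄
  have i₁ := DFunLike.congr_fun hconj (hQ.assoc x y z)
  have i₂ := DFunLike.congr_fun hconj (hQ.assoc y z w)
  have i₃ := DFunLike.congr_fun hconj (hQ.assoc z w x)
  have i₄ := DFunLike.congr_fun hconj (hQ.assoc w x y)
  simp only [conj_mul, hQ.conj_select_of_add f₁, hQ.conj_select_of_fixed (l _ _ _),
    hQ.conj_select_of_fixed (m _ _ _), hQ.conj_select_of_fixed (r _ _ _), map_add, conj_indicator,
    hQ.conj_select_of_add f₂, hQ.conj_select_of_add f₃, hQ.conj_select_of_add f₄,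
    hQ.conj_select_of_fixed c₂, hQ.conj_select_of_fixed c₃,
    hQ.conj_select_of_fixed c₄, add_right_inj] at i₁ i₂ i₃ i₄
  exact Prod.ext (indicator_inj hc i₁) (Prod.ext (indicator_inj hc i₂)
    (Prod.ext (indicator_inj hc i₃) (indicator_inj hc i₄)))

theorem exists_assocComm_ne_zero (h : ∃ x y z : Q, associator x y z ∉ center Q) :
    ∃ w x y z : Q, hQ.assocComm w x y z ≠ 0 := by
  obtain ⟨x, y, z, h⟩ := h
  by_contra! hc
  refine h ⟨hQ.associator_mem_nucleus x y z, fun w => ?_⟩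
  have hw := hQ.mul_conj w (hQ.assoc x y z)
  rw [conj_assoc, hc, add_zero] at hw
  exact hw.symm

theorem assoc_mem (x y z : Q) : hQ.assoc x y z ∈ NucleusCenter.associatorSubgroup Q :=
  fun _ h => h ⟨x, y, z, rfl⟩

/-- The cocycle relation writes the conjugated associator as a combination of associators, so no
separate proof that A(Q) is invariant under conjugation is needed. -/
theorem assocComm_mem (w x y z : Q) : hQ.assocComm w x y z ∈ NucleusCenter.associatorSubgroup Q := by
  rw [assocComm_rotate]
  refine add_mem (hQ.assoc_mem w x y) ?_
  have h := eq_sub_of_add_eq' (hQ.assoc_cocycle w x y z).symm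
  rw [h]
  exact sub_mem (add_mem (hQ.assoc_mem _ _ _) (hQ.assoc_mem _ _ _))
    (add_mem (hQ.assoc_mem _ _ _) (hQ.assoc_mem _ _ _))

theorem combination_mem (w x y z : Q) (e : Bool × Bool × Bool × Bool × Bool) :
    hQ.combination w x y z e ∈ NucleusCenter.associatorSubgroup Q := by
  have h : ∀ (b : Bool) {a}, a ∈ NucleusCenter.associatorSubgroup Q →
      indicator b a ∈ NucleusCenter.associatorSubgroup Q := by
    intro b a ha
    cases b
    · exact zero_mem _
    · exact ha
  exact add_mem (h _ (hQ.assoc_mem _ _ _)) (add_mem (h _ (hQ.assoc_mem _ _ _))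
    (add_mem (h _ (hQ.assoc_mem _ _ _)) (add_mem (h _ (hQ.assoc_mem _ _ _))
      (h _ (hQ.assocComm_mem _ _ _ _)))))

theorem card_associatorSubloop_ge [Finite Q] {w x y z : Q} (hc : hQ.assocComm w x y z ≠ 0) :
    32 ≤ Nat.card (associatorSubloop Q) := by
  have h := Nat.card_le_card_of_injective
    (fun e => (⟨(hQ.combination w x y z e).1, hQ.combination_mem w x y z e⟩ :
      associatorSubloop Q))
    fun e e' h => hQ.combination_injective hc (NucleusCenter.ext (congrArg Subtype.val h))
  simpa using h

theorem card_nucleusQuotient_ge [Finite Q] {w x y z : Q} (hc : hQ.assocComm w x y z ≠ 0) :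
    16 ≤ Nat.card hQ.NucleusQuotient := by
  have : Finite hQ.NucleusQuotient := Quotient.finite _
  simpa using Nat.card_le_card_of_injective _ (hQ.select_injective hc)

include hQ in
theorem mem_twoTorsion {a : Q} (ha : a ∈ associatorSubloop Q) :
    ∃ k : NucleusCenter Q, k.1 = a ∧ k + k = 0 := by
  refine ha (NucleusCenter.twoTorsion Q) ?_
  rintro _ ⟨x, y, z, rfl⟩
  exact ⟨hQ.assoc x y z, rfl, by nth_rw 1 [← neg_assoc]; exact neg_add_cancel _⟩

theorem dvd_card_of_le_of_mul_self {G : Type*} [Group G] [Finite G] (h : ∀ g : G, g * g = 1)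
    {n : ℕ} (hn : 2 ^ n ≤ Nat.card G) : 2 ^ n ∣ Nat.card G := by
  have hG : IsPGroup 2 G := fun g => ⟨1, by rw [pow_one, pow_two, h]⟩
  obtain ⟨k, hk⟩ := IsPGroup.iff_card.1 hG
  rw [hk] at hn ⊢
  exact pow_dvd_pow 2 ((Nat.pow_le_pow_iff_right (by norm_num)).1 hn)

include hQ in
theorem dvd_card_nucleus [Finite Q] (h : 32 ≤ Nat.card (associatorSubloop Q)) :
    32 ∣ Nat.card (nucleus Q) := by
  -- A(Q) lies in the nucleus, so it is a subgroup of exponent two there and Lagrange's theorem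
  -- applies.
  let S : Subgroup (nucleus Q) :=
    { carrier := {n | n.1 ∈ associatorSubloop Q}
      one_mem' := (associatorSubloop Q).one_mem'
      mul_mem' := fun ha hb => (associatorSubloop Q).mul_mem' ha hb
      inv_mem' := fun ha => (associatorSubloop Q).rdiv_mem' (associatorSubloop Q).one_mem' ha }
  have hS : Nat.card S = Nat.card (associatorSubloop Q) := Nat.card_congr
    { toFun s := ⟨s.1.1, s.2⟩
      invFun a := ⟨⟨a.1, by
        obtain ⟨k, hk, -⟩ := hQ.mem_twoTorsion a.2
        rw [← hk]
        exact k.mem⟩, a.2⟩ }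
  have h2 : ∀ s : S, s * s = 1 := by
    intro s
    obtain ⟨k, hk, hkk⟩ := hQ.mem_twoTorsion s.2
    have h0 := congrArg NucleusCenter.val hkk
    rw [NucleusCenter.val_add, hk] at h0
    exact Subtype.ext (Subtype.ext h0)
  have := dvd_card_of_le_of_mul_self h2 (n := 5) (by rw [hS]; exact h)
  exact this.trans (Subgroup.card_subgroup_dvd_card S)

theorem dvd_card_nucleusQuotient [Finite Q] (h : 16 ≤ Nat.card hQ.NucleusQuotient) :
    16 ∣ Nat.card hQ.NucleusQuotient := by
  have : Finite hQ.NucleusQuotient := Quotient.finite _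
  exact dvd_card_of_le_of_mul_self hQ.nucleusQuotient_mul_self (n := 4) h

theorem card_eq : Nat.card Q = Nat.card hQ.NucleusQuotient * Nat.card (nucleus Q) := by
  rw [← Nat.card_prod]
  -- Each element is uniquely a chosen coset representative times a nuclear element.
  refine (Nat.card_congr (Equiv.ofBijective
    (fun p : hQ.NucleusQuotient × nucleus Q => Quotient.out p.1 * p.2.1) ⟨?_, ?_⟩)).symm
  · rintro ⟨a, n⟩ ⟨b, m⟩ h
    have h' : ∀ (a : hQ.NucleusQuotient) (n : nucleus Q),
        ((Quotient.out a * n.1 : Q) : hQ.NucleusQuotient) = a := fun a n =>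
      (hQ.nucleusQuotient_eq.2 ⟨n.1, n.2, rfl⟩).symm.trans (Quotient.out_eq a)
    have hab : a = b := by rw [← h' a n, ← h' b m]; exact congrArg _ h
    subst hab
    exact Prod.ext rfl (Subtype.ext (mul_left_cancel' h))
  · intro x
    have hx : ((Quotient.out (x : hQ.NucleusQuotient) : Q) : hQ.NucleusQuotient) = x :=
      Quotient.out_eq _
    obtain ⟨n, hn, h⟩ := hQ.nucleusQuotient_eq.1 hx
    exact ⟨⟨x, n, hn⟩, h.symm⟩

theorem index_nucleus : (nucleus Q).index = Nat.card hQ.NucleusQuotient := by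
  have h : Setoid.ker (fun x : Q => (fun h : Q => x * h) '' (nucleus Q : Set Q)) =
      hQ.nucleusCon.toSetoid := by
    ext x y
    constructor
    · intro h
      have hy : y ∈ (fun h : Q => y * h) '' (nucleus Q : Set Q) :=
        ⟨1, (nucleus Q).one_mem', mul_one y⟩
      rw [← Setoid.ker_def.1 h] at hy
      obtain ⟨n, hn, h⟩ := hy
      exact ⟨n, hn, h.symm⟩
    · have key : ∀ {x y : Q}, hQ.nucleusCon x y → (fun h : Q => y * h) '' (nucleus Q : Set Q) ⊆
          (fun h : Q => x * h) '' (nucleus Q : Set Q) := by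
        rintro x _ ⟨n, hn, rfl⟩ _ ⟨m, hm, rfl⟩
        exact ⟨n * m, (nucleus Q).mul_mem' hn hm, (nucleus_middle hn _ _).symm⟩
      exact fun h => Setoid.ker_def.2 (Set.Subset.antisymm (key (hQ.nucleusCon.symm h)) (key h))
  rw [Subloop.index, ← Nat.card_congr (Setoid.quotientKerEquivRange _), h]
  rfl

end Counting

end IsExtraLoop

theorem isGroup_centerQuotient {Q : Type u} [Loop Q]
    (h : ∀ x y z : Q, associator x y z ∈ center Q) : IsGroup (CenterQuotient Q) := by
  have hassoc : ∀ a b c : CenterQuotient Q, a * b * c = a * (b * c) := by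
    intro a b c
    induction a using Con.induction_on with
    | H x =>
      induction b using Con.induction_on with
      | H y =>
        induction c using Con.induction_on with
        | H z =>
          exact ((Con.eq (centerCon Q)).2 ⟨_, h x y z, associator_spec x y z⟩).symm
  have hinv : ∀ a : CenterQuotient Q, ∃ b, b * a = 1 := by
    intro a
    induction a using Con.induction_on with
    | H x => exact ⟨(Loop.rdiv 1 x : Q), congrArg ((↑) : Q → CenterQuotient Q) (Loop.rdiv_mul 1 x)⟩
  choose inv hinv using hinv
  exact ⟨{ mul := (· * ·), mul_assoc := hassoc, one := 1, one_mul := one_mul, mul_one := mul_one,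
           inv := inv, inv_mul_cancel := hinv }, fun _ _ => rfl⟩

end LoopTheory

theorem mainTheorem4 (Q : Type*) [LoopTheory.Loop Q] [Finite Q]
    (hQ : LoopTheory.IsExtraLoop Q) :
    ((∃ x y z : Q, LoopTheory.associator x y z ∉ LoopTheory.center Q) →
      32 ≤ Nat.card (LoopTheory.associatorSubloop Q) ∧
      16 ≤ (LoopTheory.nucleus Q).index ∧
      512 ∣ Nat.card Q) ∧
    (Nat.card Q < 512 → LoopTheory.IsGroup (LoopTheory.CenterQuotient Q)) := by
  have key : (∃ x y z : Q, LoopTheory.associator x y z ∉ LoopTheory.center Q) →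
      32 ≤ Nat.card (LoopTheory.associatorSubloop Q) ∧
      16 ≤ (LoopTheory.nucleus Q).index ∧ 512 ∣ Nat.card Q := by
    intro h
    obtain ⟨w, x, y, z, hc⟩ := hQ.exists_assocComm_ne_zero h
    have hA := hQ.card_associatorSubloop_ge hc
    have hB := hQ.card_nucleusQuotient_ge hc
    refine ⟨hA, hQ.index_nucleus ▸ hB, ?_⟩
    rw [hQ.card_eq]
    -- 512 = 16 · 32.
    exact mul_dvd_mul (hQ.dvd_card_nucleusQuotient hB) (hQ.dvd_card_nucleus hA)
  refine ⟨key, fun hlt => LoopTheory.isGroup_centerQuotient ?_⟩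
  by_contra! h
  have : Nonempty Q := ⟨1⟩
  exact absurd (Nat.le_of_dvd Nat.card_pos (key h).2.2) (not_le.2 hlt)
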